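/- All Banach spaces are over a fixed scalar field, either $\mathbb R$ or $\mathbb C$. For Banach spaces $X,Y$, let $L(X,Y)$ be the Banach space of bounded linear operators with the operator norm and $K(X,Y)$ its closed subspace of compact operators. A closed subspace $J$ of a Banach space $E$ is called an $M$-ideal in $E$ if there is a closed subspace $V\subset E^*$ such that $E^*=J^\perp\oplus V$ and $\|f+g\|=\|f\|+\|g\|$ for all $f\in J^\perp$, $g\in V$, where $J^\perp=\{f\in E^*: f|_J=0\}$. Let $1\le p\le\infty$. An operator $T\in L(X,Y)$ has the $p$-averaged property $(M^*)$ if $$\limsup_n\|x^*+T^*y_n^*\|\le\limsup_n\left(\frac{\|y^*+y_n^*\|^p+\|y^*-y_n^*\|^p}{2}\right)^{1/p}$$ (for $p=\infty$ the right-hand side is $\limsup_n\max(\|y^*+y_n^*\|,\|y^*-y_n^*\|)$) for all $x^*\in X^*$ and $y^*\in Y^*$ with $\|x^*\|\le\|y^*\|$ and all sequences $(y_n^*)\subset Y^*$ converging to $0$ in the weak$^*$ topology. **Proposition.** Let $1\le p\le\infty$ and suppose that the Banach space $Y$ admits a sequence of compact operators $K_n\in K(Y,Y)$ satisfying (a)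 $K_ny\to y$ in norm for all $y\in Y$; (b) $K_n^*y^*\to y^*$ in norm for all $y^*\in Y^*$; (c) $\|\mathrm{Id}_Y-2K_n\|\to1$. Let $X$ be a Banach space. Then $K(X,Y)$ is an $M$-ideal in $L(X,Y)$ if and only if every $T\in L(X,Y)$ with $\|T\|\le1$ has the $p$-averaged property $(M^*)$. -/

import Mathlib

open Filter Topology
open scoped ENNReal

/-- The annihilator `J^⊥ = {f ∈ E^* : f = 0 on J}` of a subspace `J` of a normed space `E`. -/
def annihilatorInDual {𝕜 E : Type*} [RCLike 𝕜] [NormedAddCommGroup E] [NormedSpace 𝕜 E]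
    (J : Submodule 𝕜 E) : Submodule 𝕜 (StrongDual 𝕜 E) where
  carrier := {f | ∀ x ∈ J, f x = 0}
  zero_mem' := fun x _ => rfl
  add_mem' := fun {f g} hf hg x hx => by simp [hf x hx, hg x hx]
  smul_mem' := fun c f hf x hx => by simp [hf x hx]

/-- A closed subspace `J` of `E` is an M-ideal in `E` if `E^* = J^⊥ ⊕₁ V` for some closed
subspace `V` of `E^*`: an algebraic direct sum in which `‖f + g‖ = ‖f‖ + ‖g‖` for `f ∈ J^⊥`
and `g ∈ V`. -/
def IsMIdeal {𝕜 E : Type*} [RCLike 𝕜] [NormedAddCommGroup E] [NormedSpace 𝕜 E]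
    (J : Submodule 𝕜 E) : Prop :=
  IsClosed (J : Set E) ∧
    ∃ V : Submodule 𝕜 (StrongDual 𝕜 E), IsClosed (V : Set (StrongDual 𝕜 E)) ∧
      IsCompl (annihilatorInDual J) V ∧
      ∀ f ∈ annihilatorInDual J, ∀ g ∈ V, ‖f + g‖ = ‖f‖ + ‖g‖

/-- The normalized `p`-mean of two nonnegative reals, `((a ^ p + b ^ p) / 2) ^ (1 / p)` for
`p < ∞` and `max a b` for `p = ∞`. -/
noncomputable def pMean (p : ℝ≥0∞) (a b : ℝ) : ℝ :=
  if p = ∞ then max a b else ((a ^ p.toReal + b ^ p.toReal) / 2) ^ (1 / p.toReal)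

/-- The `p`-averaged property `(M^*)` of an operator `T : X → Y`. The Banach space adjoint of `T`
is `f ↦ f.comp T`. The upper limits are taken in the extended reals, so that they are
meaningful without any boundedness assumption. -/
def HasAveragedMStar {𝕜 X Y : Type*} [RCLike 𝕜] [NormedAddCommGroup X] [NormedSpace 𝕜 X]
    [NormedAddCommGroup Y] [NormedSpace 𝕜 Y] (p : ℝ≥0∞) (T : X →L[𝕜] Y) : Prop :=
  ∀ (x' : StrongDual 𝕜 X) (y' : StrongDual 𝕜 Y) (ys : ℕ → StrongDual 𝕜 Y),
    ‖x'‖ ≤ ‖y'‖ →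
    Tendsto (fun n => StrongDual.toWeakDual (ys n)) atTop (𝓝 0) →
    limsup (fun n => ((‖x' + (ys n).comp T‖ : ℝ) : EReal)) atTop ≤
      limsup (fun n => ((pMean p ‖y' + ys n‖ ‖y' - ys n‖ : ℝ) : EReal)) atTop

/-! ### Compactness, separability and weak* limits. -/

section CompactOperators

variable {𝕜 X Y Z : Type*} [RCLike 𝕜] [NormedAddCommGroup X] [NormedSpace 𝕜 X]
  [NormedAddCommGroup Y] [NormedSpace 𝕜 Y] [NormedAddCommGroup Z] [NormedSpace 𝕜 Z]

/-! Both directions compare `T` with its compact approximations `K n ∘ T`. If E* = J^⊥ ⊕₁ V, then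
functionals in V satisfy h(K_n T) → h(T). Writing f = g + h, the values f(S + T - K_n T) tend to
g(T) + h(S), of modulus at most max(‖S‖, ‖T‖)‖f‖. Hahn–Banach separation turns this into an operator
U with ‖S + T - U‖ almost bounded by that maximum. With S of rank one, S*y* = x*, and U compact,
U*y* ≈ T*y*, the vector x* + T*y_n* is close to (S + T - U)*(y* + y_n*), since compact adjoints send
bounded weak* null sequences to norm null ones. This gives the pointwise bound by ‖y* + y_n*‖,
hence, using -y* too, by the minimum of both norms, which every p-mean dominates. Conversely, the
averaged property gives limsup ‖S + T - K_n T‖ ≤ 1 for S compact and S, T contractions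
(`HasAveragedMStar.eventually_norm_add_lt`). Here (c) makes both norms in the p-mean almost at most
1. Testing functionals on S + T - K_n T then shows that f ↦ lim f(K_n ·) yields the L-decomposition.
-/

theorem ContinuousLinearMap.opNorm_le_of_forall_mem_ball {A : X →L[𝕜] Y} {c : ℝ}
    (h : ∀ x, ‖x‖ < 1 → ‖A x‖ ≤ c) : ‖A‖ ≤ c := by
  by_contra! hc
  obtain ⟨x, hx, hxc⟩ := A.exists_lt_apply_of_lt_opNorm hc
  exact absurd (h x hx) hxc.not_ge

theorem ContinuousLinearMap.norm_le_of_tendsto_apply {ι : Type*} {l : Filter ι} [l.NeBot]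
    {A : ι → X →L[𝕜] Y} {B : X →L[𝕜] Y} {r : ℝ} (hr : ∀ᶠ i in l, ‖A i‖ ≤ r)
    (h : ∀ x, Tendsto (fun i => A i x) l (𝓝 (B x))) : ‖B‖ ≤ r := by
  refine opNorm_le_of_forall_mem_ball fun x hx => ?_
  refine le_of_tendsto (h x).norm (hr.mono fun i hi => ?_)
  calc ‖A i x‖ ≤ ‖A i‖ * ‖x‖ := (A i).le_opNorm x
    _ ≤ ‖A i‖ * 1 := by gcongr
    _ ≤ r := by simpa using hi

/-- A bounded family of operators that converges pointwise converges in norm after composition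
with a compact operator. -/
theorem tendsto_comp_of_isCompactOperator {ι : Type*} {l : Filter ι} {A : ι → Y →L[𝕜] Z}
    {B : Y →L[𝕜] Z} {M : ℝ} (hM : ∀ᶠ i in l, ‖A i‖ ≤ M)
    (hA : ∀ y, Tendsto (fun i => A i y) l (𝓝 (B y))) {S : X →L[𝕜] Y}
    (hS : IsCompactOperator S) :
    Tendsto (fun i => (A i).comp S) l (𝓝 (B.comp S)) := by
  rw [Metric.tendsto_nhds]
  intro ε hε
  obtain ⟨C, hC, hSC⟩ :=
    IsCompactOperator.image_ball_subset_compact (𝕜₁ := 𝕜) (f := (S : X →ₗ[𝕜] Y)) hS 1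
  set N := |M| + ‖B‖ + 1 with hN
  have hN0 : 0 < N := by positivity
  have hδ : 0 < ε / (4 * N) := by positivity
  obtain ⟨t, -, htf, hCt⟩ := hC.finite_cover_balls hδ
  have hev : ∀ᶠ i in l, ∀ y ∈ t, ‖A i y - B y‖ < ε / 4 := by
    rw [htf.eventually_all]
    intro y _
    simpa [dist_eq_norm] using (Metric.tendsto_nhds.1 (hA y)) (ε / 4) (by positivity)
  filter_upwards [hM, hev] with i hi hit
  rw [dist_eq_norm, ← ContinuousLinearMap.sub_comp]
  refine lt_of_le_of_lt (b := ε / 2) (ContinuousLinearMap.opNorm_le_of_forall_mem_ball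
    fun x hx => ?_) (by linarith)
  obtain ⟨y, hy, hxy⟩ : ∃ y ∈ t, S x ∈ Metric.ball y (ε / (4 * N)) := by
    simpa using hCt (hSC ⟨x, by simpa using hx, rfl⟩)
  rw [mem_ball_iff_norm] at hxy
  have hAB : ‖A i - B‖ ≤ N := by
    have := norm_sub_le (A i) B
    have := le_abs_self M
    linarith
  calc ‖((A i - B).comp S) x‖ = ‖(A i - B) (S x - y) + (A i y - B y)‖ := by
        congr 1
        simp only [ContinuousLinearMap.comp_apply, _root_.sub_apply, map_sub]
        abel
    _ ≤ ‖(A i - B) (S x - y)‖ + ‖A i y - B y‖ := norm_add_le _ _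
    _ ≤ N * (ε / (4 * N)) + ε / 4 := by
        gcongr
        · exact ((A i - B).le_opNorm _).trans (by gcongr)
        · exact (hit y hy).le
    _ = ε / 2 := by field_simp; ring

theorem IsCompactOperator.isSeparable_range {S : X →L[𝕜] Y} (hS : IsCompactOperator S) :
    TopologicalSpace.IsSeparable (Set.range S) := by
  have : Set.range S ⊆ ⋃ n : ℕ, S '' Metric.ball 0 n := by
    rintro _ ⟨x, rfl⟩
    obtain ⟨n, hn⟩ := exists_nat_gt ‖x‖
    exact Set.mem_iUnion.2 ⟨n, x, by simpa using hn, rfl⟩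
  refine TopologicalSpace.IsSeparable.mono
    (TopologicalSpace.IsSeparable.iUnion fun n => ?_) this
  obtain ⟨C, hC, hSC⟩ :=
    IsCompactOperator.image_ball_subset_compact (𝕜₁ := 𝕜) (f := (S : X →ₗ[𝕜] Y)) hS n
  exact hC.isSeparable.mono hSC

/-- Compact operators have separable range, and these ranges have dense union. Separability is what
provides weak* convergent subsequences, as the averaged property speaks only of sequences. -/
theorem separableSpace_of_tendsto_compact {K : ℕ → Y →L[𝕜] Y}
    (hK : ∀ n, IsCompactOperator (K n)) (ha : ∀ y : Y, Tendsto (fun n => K n y) atTop (𝓝 y)) :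
    TopologicalSpace.SeparableSpace Y := by
  rw [← TopologicalSpace.isSeparable_univ_iff]
  refine (TopologicalSpace.IsSeparable.iUnion fun n =>
    (hK n).isSeparable_range).closure.mono fun y _ => ?_
  exact mem_closure_of_tendsto (ha y)
    (Eventually.of_forall fun n => Set.mem_iUnion.2 ⟨n, y, rfl⟩)

/-- Banach–Alaoglu for ultrafilters: bounded functionals have a pointwise ultralimit. -/
theorem Ultrafilter.exists_tendsto_strongDual {ι : Type*} (l : Ultrafilter ι)
    {f : ι → StrongDual 𝕜 X} {r : ℝ} (hr : ∀ᶠ i in (l : Filter ι), ‖f i‖ ≤ r) :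
    ∃ g : StrongDual 𝕜 X, ∀ x, Tendsto (fun i => f i x) l (𝓝 (g x)) := by
  obtain ⟨g, -, hg⟩ := (WeakDual.isCompact_closedBall (𝕜 := 𝕜) (E := X) 0 r).ultrafilter_le_nhds
    (l.map fun i => StrongDual.toWeakDual (f i)) (by
      rw [le_principal_iff, Ultrafilter.mem_coe, Ultrafilter.mem_map]
      exact l.sets_of_superset hr fun i hi => by simpa using hi)
  refine ⟨WeakDual.toStrongDual g, fun x => ?_⟩
  exact ((WeakDual.eval_continuous x).tendsto g).comp hg

theorem exists_strictMono_tendsto_strongDual [TopologicalSpace.SeparableSpace X]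
    {f : ℕ → StrongDual 𝕜 X} {r : ℝ} (hr : ∀ n, ‖f n‖ ≤ r) :
    ∃ (g : StrongDual 𝕜 X) (φ : ℕ → ℕ), ‖g‖ ≤ r ∧ StrictMono φ ∧
      ∀ x, Tendsto (fun n => f (φ n) x) atTop (𝓝 (g x)) := by
  obtain ⟨g, hg, φ, hφ, h⟩ := (WeakDual.isSeqCompact_closedBall 𝕜 X 0 r)
    (x := fun n => StrongDual.toWeakDual (f n)) (fun n => by simpa using hr n)
  refine ⟨WeakDual.toStrongDual g, φ, by simpa using hg, hφ, fun x => ?_⟩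
  exact ((WeakDual.eval_continuous x).tendsto g).comp h

theorem tendsto_toWeakDual_zero_iff {ι : Type*} {l : Filter ι} {f : ι → StrongDual 𝕜 X} :
    Tendsto (fun i => StrongDual.toWeakDual (f i)) l (𝓝 0) ↔
      ∀ x, Tendsto (fun i => f i x) l (𝓝 0) :=
  tendsto_iff_forall_eval_tendsto_topDualPairing

theorem exists_bound_of_tendsto_apply [CompleteSpace X] {f : ℕ → StrongDual 𝕜 X}
    {g : X → 𝕜} (h : ∀ x, Tendsto (fun n => f n x) atTop (𝓝 (g x))) : ∃ M, ∀ n, ‖f n‖ ≤ M := by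
  refine banach_steinhaus fun x => ?_
  obtain ⟨M, hM⟩ := (h x).norm.bddAbove_range
  exact ⟨M, fun n => hM ⟨n, rfl⟩⟩

end CompactOperators

/-! ### The only two bounds on p-means needed, which make `p` irrelevant. -/

section PMean

theorem min_le_pMean {p : ℝ≥0∞} (hp : 1 ≤ p) {a b : ℝ} (ha : 0 ≤ a) (hb : 0 ≤ b) :
    min a b ≤ pMean p a b := by
  unfold pMean
  split_ifs with h
  · exact min_le_max
  have hp0 : 0 < p.toReal := ENNReal.toReal_pos (by positivity) h
  have hm : 0 ≤ min a b := le_min ha hb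
  rw [one_div, Real.le_rpow_inv_iff_of_pos hm (by positivity) hp0]
  have h1 := Real.rpow_le_rpow hm (min_le_left a b) hp0.le
  have h2 := Real.rpow_le_rpow hm (min_le_right a b) hp0.le
  linarith

theorem pMean_le {p : ℝ≥0∞} (hp : 1 ≤ p) {a b c : ℝ} (ha : 0 ≤ a) (hb : 0 ≤ b) (hac : a ≤ c)
    (hbc : b ≤ c) : pMean p a b ≤ c := by
  unfold pMean
  split_ifs with h
  · exact max_le hac hbc
  have hp0 : 0 < p.toReal := ENNReal.toReal_pos (by positivity) h
  rw [one_div, Real.rpow_inv_le_iff_of_pos (by positivity) (ha.trans hac) hp0]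
  have h1 := Real.rpow_le_rpow ha hac hp0.le
  have h2 := Real.rpow_le_rpow hb hbc hp0.le
  linarith

end PMean

/-! ### From M-ideals to property (M*). -/

section Forward

variable {𝕜 X Y : Type*} [RCLike 𝕜] [NormedAddCommGroup X] [NormedSpace 𝕜 X]
  [NormedAddCommGroup Y] [NormedSpace 𝕜 Y]

theorem norm_le_half_one_add_norm_id_sub_two_smul (K : Y →L[𝕜] Y) :
    ‖K‖ ≤ (1 + ‖ContinuousLinearMap.id 𝕜 Y - (2 : 𝕜) • K‖) / 2 := by
  have h : (2 : 𝕜) • K = ContinuousLinearMap.id 𝕜 Y -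
      (ContinuousLinearMap.id 𝕜 Y - (2 : 𝕜) • K) := by abel
  have h1 : ‖(2 : 𝕜) • K‖ = 2 * ‖K‖ := by rw [norm_smul]; simp
  have h2 := norm_sub_le (ContinuousLinearMap.id 𝕜 Y)
    (ContinuousLinearMap.id 𝕜 Y - (2 : 𝕜) • K)
  rw [← h, h1] at h2
  have h3 := ContinuousLinearMap.norm_id_le (𝕜 := 𝕜) (E := Y)
  linarith

theorem eventually_norm_le_of_tendsto {K : ℕ → Y →L[𝕜] Y}
    (hc : Tendsto (fun n => ‖ContinuousLinearMap.id 𝕜 Y - (2 : 𝕜) • K n‖) atTop (𝓝 1))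
    {c : ℝ} (h : 1 < c) : ∀ᶠ n in atTop, ‖K n‖ ≤ c := by
  filter_upwards [hc.eventually_lt_const h] with n hn
  have := norm_le_half_one_add_norm_id_sub_two_smul (K n)
  linarith

/-- Functionals in the `L`-complement of the annihilator of an M-ideal are determined by their
values on the ideal: an approximate identity of the ideal is seen by them. -/
theorem IsMIdeal.tendsto_apply_comp {V : Submodule 𝕜 (StrongDual 𝕜 (X →L[𝕜] Y))}
    (hV : ∀ f ∈ annihilatorInDual (compactOperator (RingHom.id 𝕜) X Y), ∀ g ∈ V,
      ‖f + g‖ = ‖f‖ + ‖g‖)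
    {K : ℕ → Y →L[𝕜] Y} (ha : ∀ y : Y, Tendsto (fun n => K n y) atTop (𝓝 y))
    (hb : ∀ c : ℝ, 1 < c → ∀ᶠ n in atTop, ‖K n‖ ≤ c)
    {h : StrongDual 𝕜 (X →L[𝕜] Y)} (hh : h ∈ V) (T : X →L[𝕜] Y) :
    Tendsto (fun n => h ((K n).comp T)) atTop (𝓝 (h T)) := by
  rw [tendsto_iff_ultrafilter]
  intro l hl
  set f : ℕ → StrongDual 𝕜 (X →L[𝕜] Y) := fun n =>
    h.comp (ContinuousLinearMap.compL 𝕜 X Y Y (K n)) with hf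
  have hfn : ∀ c : ℝ, 1 < c → ∀ᶠ n in (l : Filter ℕ), ‖f n‖ ≤ ‖h‖ * c := by
    intro c hc
    filter_upwards [hl (hb c hc)] with n hn
    refine ContinuousLinearMap.opNorm_le_bound _ (by positivity) fun T => ?_
    calc ‖h ((K n).comp T)‖ ≤ ‖h‖ * (‖K n‖ * ‖T‖) :=
          (h.le_opNorm _).trans (by gcongr; exact ContinuousLinearMap.opNorm_comp_le _ _)
      _ ≤ ‖h‖ * c * ‖T‖ := by rw [mul_assoc]; gcongr
  obtain ⟨g, hg⟩ := l.exists_tendsto_strongDual (hfn 2 one_lt_two)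
  have hgn : ‖g‖ ≤ ‖h‖ := by
    have hlim : Tendsto (fun c : ℝ => ‖h‖ * c) (𝓝[>] 1) (𝓝 (‖h‖ * 1)) :=
      ((continuous_const.mul continuous_id).tendsto 1).mono_left nhdsWithin_le_nhds
    rw [mul_one] at hlim
    -- Only limsup ‖K n‖ ≤ 1 is available, so the bound ‖h‖ * c is proved for each c > 1 and c tends
    -- to 1.
    refine ge_of_tendsto hlim ?_
    filter_upwards [self_mem_nhdsWithin] with c hc
    exact ContinuousLinearMap.norm_le_of_tendsto_apply (hfn c hc) hg
  have hgh : g - h ∈ annihilatorInDual (compactOperator (RingHom.id 𝕜) X Y) := by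
    intro S hS
    have h1 : Tendsto (fun n => (K n).comp S) l (𝓝 ((ContinuousLinearMap.id 𝕜 Y).comp S)) :=
      (tendsto_comp_of_isCompactOperator (hb 2 one_lt_two) (fun y => by simpa using ha y)
        hS).mono_left hl
    have h2 := (h.continuous.tendsto _).comp h1
    have h3 := tendsto_nhds_unique (hg S) h2
    simp [h3]
  -- Norm additivity gives ‖g‖ = ‖g - h‖ + ‖h‖, while ‖g‖ ≤ ‖h‖; hence g = h.
  have heq := hV _ hgh h hh
  rw [sub_add_cancel] at heq
  have : g = h := by
    rw [← sub_eq_zero, ← norm_eq_zero]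
    exact le_antisymm (by linarith) (norm_nonneg _)
  have hT := hg T
  rw [this] at hT
  exact hT

theorem RCLike.exists_norm_eq_one_mul_eq_norm (z : 𝕜) : ∃ c : 𝕜, ‖c‖ = 1 ∧ c * z = ‖z‖ := by
  by_cases hz : z = 0
  · exact ⟨1, by simp, by simp [hz]⟩
  refine ⟨(‖z‖ : 𝕜) / z, by simp [hz], div_mul_cancel₀ _ hz⟩

theorem exists_apply_eq_ofReal_of_lt_norm {f : StrongDual 𝕜 X} {c : ℝ} (hc : c < ‖f‖) :
    ∃ (x : X) (t : ℝ), ‖x‖ < 1 ∧ c < t ∧ f x = (t : 𝕜) := by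
  obtain ⟨z, hz, hzf⟩ := f.exists_lt_apply_of_lt_opNorm hc
  obtain ⟨a, ha, haz⟩ := RCLike.exists_norm_eq_one_mul_eq_norm (f z)
  exact ⟨a • z, ‖f z‖, by rwa [norm_smul, ha, one_mul], hzf, by rwa [map_smul, smul_eq_mul]⟩

/-- A convex set contains vectors of norm less than `r + ε` as soon as every functional `f` takes
on it values of modulus almost at most `r * ‖f‖`. -/
theorem exists_mem_norm_lt_of_forall_functional {E : Type*} [NormedAddCommGroup E]
    [NormedSpace 𝕜 E] [NormedSpace ℝ E] [IsScalarTower ℝ 𝕜 E] {C : Set E} (hC : Convex ℝ C)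
    {r ε : ℝ} (hr : 0 ≤ r) (hε : 0 < ε)
    (h : ∀ f : StrongDual 𝕜 E, ∀ δ > 0, ∃ x ∈ C, ‖f x‖ ≤ r * ‖f‖ + δ) :
    ∃ x ∈ C, ‖x‖ < r + ε := by
  by_contra! hcon
  have hdisj : Disjoint (Metric.ball (0 : E) (r + ε)) C := by
    rw [Set.disjoint_left]
    intro x hx hxC
    exact absurd (by simpa using hx) (hcon x hxC).not_gt
  obtain ⟨f, u, hfu, huf⟩ := RCLike.geometric_hahn_banach_open (𝕜 := 𝕜)
    (convex_ball (0 : E) (r + ε)) Metric.isOpen_ball hC hdisj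
  have hu : 0 < u := by simpa using hfu 0 (by simp; positivity)
  have hur : u ≤ r * ‖f‖ := le_of_forall_pos_le_add fun δ hδ => by
    obtain ⟨x, hx, hxf⟩ := h f δ hδ
    exact (huf x hx).trans ((RCLike.re_le_norm _).trans hxf)
  have hf : 0 < ‖f‖ := by
    rcases (norm_nonneg f).eq_or_lt with h0 | h0
    · rw [← h0] at hur; linarith
    · exact h0
  obtain ⟨z, t, hz, hzt, hft⟩ := exists_apply_eq_ofReal_of_lt_norm (f := f)
    (c := r / (r + ε) * ‖f‖) (by
      have : r / (r + ε) < 1 := by rw [div_lt_one (by positivity)]; linarith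
      nlinarith)
  have hlt := hfu (((r + ε : ℝ) : 𝕜) • z) (by
    rw [mem_ball_zero_iff, norm_smul, RCLike.norm_ofReal, abs_of_pos (by positivity)]
    nlinarith)
  rw [map_smul, hft, smul_eq_mul, ← RCLike.ofReal_mul, RCLike.ofReal_re] at hlt
  rw [div_mul_eq_mul_div, div_lt_iff₀ (by positivity)] at hzt
  linarith

/-- If the compact operators form an M-ideal, then `T` can be approximated by operators `U` in any
convex set containing almost all `K n ∘ T`, with good control of `‖S + T - U‖`. -/
theorem IsMIdeal.exists_norm_add_sub_lt
    (hJ : IsMIdeal (𝕜 := 𝕜) (compactOperator (RingHom.id 𝕜) X Y))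
    {K : ℕ → Y →L[𝕜] Y} (ha : ∀ y : Y, Tendsto (fun n => K n y) atTop (𝓝 y))
    (hb : ∀ c : ℝ, 1 < c → ∀ᶠ n in atTop, ‖K n‖ ≤ c)
    {S T : X →L[𝕜] Y} (hK : ∀ n, IsCompactOperator (K n)) (hS : IsCompactOperator S)
    {r ε : ℝ} (hr : 0 ≤ r) (hε : 0 < ε) (hSr : ‖S‖ ≤ r) (hTr : ‖T‖ ≤ r)
    {C : Set (X →L[𝕜] Y)}
    (hC : ∀ U ∈ C, ∀ U' ∈ C, ∀ a b : ℝ, 0 ≤ a → 0 ≤ b → a + b = 1 →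
      (a : 𝕜) • U + (b : 𝕜) • U' ∈ C)
    (hKC : ∀ᶠ n in atTop, (K n).comp T ∈ C) :
    ∃ U ∈ C, ‖S + T - U‖ < r + ε := by
  obtain ⟨-, V, -, hVc, hV⟩ := hJ
  let _ : NormedSpace ℝ (X →L[𝕜] Y) := NormedSpace.restrictScalars ℝ 𝕜 (X →L[𝕜] Y)
  have hsmul : ∀ (a : ℝ) (U : X →L[𝕜] Y), a • U = (a : 𝕜) • U := fun a U => rfl
  have : IsScalarTower ℝ 𝕜 (X →L[𝕜] Y) :=
    ⟨fun a b U => by rw [hsmul, smul_smul, RCLike.real_smul_eq_coe_mul]⟩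
  have hconv : Convex ℝ ((fun U => S + T - U) '' C) := by
    rintro _ ⟨U, hU, rfl⟩ _ ⟨U', hU', rfl⟩ a b h0 h1 hab
    refine ⟨_, hC U hU U' hU' a b h0 h1 hab, ?_⟩
    have : (S + T) = a • (S + T) + b • (S + T) := by rw [← add_smul, hab, one_smul]
    simp only [← hsmul]
    nth_rewrite 1 [this]
    rw [smul_sub, smul_sub]
    abel
  obtain ⟨_, ⟨U, hU, rfl⟩, hlt⟩ := exists_mem_norm_lt_of_forall_functional (𝕜 := 𝕜) hconv hr hε
    (fun f δ hδ => by
      obtain ⟨g, hg, h, hh, rfl⟩ : ∃ g ∈ annihilatorInDual (compactOperator (RingHom.id 𝕜) X Y),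
          ∃ h ∈ V, g + h = f := by
        have : f ∈ annihilatorInDual (compactOperator (RingHom.id 𝕜) X Y) ⊔ V := by
          rw [hVc.sup_eq_top]; trivial
        exact Submodule.mem_sup.1 this
      have hlim : Tendsto (fun n => g T + h S + (h T - h ((K n).comp T))) atTop
          (𝓝 (g T + h S + (h T - h T))) :=
        tendsto_const_nhds.add (tendsto_const_nhds.sub
          (IsMIdeal.tendsto_apply_comp hV ha hb hh T))
      rw [sub_self, add_zero] at hlim
      have hle : ‖g T + h S‖ ≤ r * ‖g + h‖ := by
        rw [hV g hg h hh, mul_add]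
        refine (norm_add_le _ _).trans (add_le_add ?_ ?_)
        · exact (g.le_opNorm T).trans (by rw [mul_comm]; gcongr)
        · exact (h.le_opNorm S).trans (by rw [mul_comm]; gcongr)
      have hev := hlim.norm.eventually_lt_const
        (show ‖g T + h S‖ < r * ‖g + h‖ + δ by linarith)
      obtain ⟨n, hn, hnC⟩ := (hev.and hKC).exists
      refine ⟨_, ⟨_, hnC, rfl⟩, ?_⟩
      have h1 : g S = 0 := hg S hS
      have h2 : g ((K n).comp T) = 0 := hg _ ((hK n).comp_clm T)
      refine le_of_eq_of_le ?_ hn.le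
      congr 1
      simp only [_root_.add_apply, map_sub, map_add, h1, h2]
      ring)
  exact ⟨U, hU, hlt⟩

/-- If the compact operators form an M-ideal, then contractions have property `(M^*)`, in an
eventual form. -/
theorem IsMIdeal.eventually_norm_add_comp_le
    (hJ : IsMIdeal (𝕜 := 𝕜) (compactOperator (RingHom.id 𝕜) X Y)) [CompleteSpace Y]
    {K : ℕ → Y →L[𝕜] Y} (hK : ∀ n, IsCompactOperator (K n))
    (ha : ∀ y : Y, Tendsto (fun n => K n y) atTop (𝓝 y))
    (hb : ∀ f : StrongDual 𝕜 Y, Tendsto (fun n => f.comp (K n)) atTop (𝓝 f))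
    (hc : ∀ c : ℝ, 1 < c → ∀ᶠ n in atTop, ‖K n‖ ≤ c)
    {T : X →L[𝕜] Y} (hT : ‖T‖ ≤ 1) {x' : StrongDual 𝕜 X} {y' : StrongDual 𝕜 Y}
    {ys : ℕ → StrongDual 𝕜 Y} (hxy : ‖x'‖ ≤ ‖y'‖)
    (hys : Tendsto (fun n => StrongDual.toWeakDual (ys n)) atTop (𝓝 0)) {δ : ℝ} (hδ : 0 < δ) :
    ∀ᶠ n in atTop, ‖x' + (ys n).comp T‖ ≤ ‖y' + ys n‖ + δ := by
  rw [tendsto_toWeakDual_zero_iff] at hys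
  obtain ⟨M, hM⟩ := exists_bound_of_tendsto_apply (g := fun _ => 0) hys
  have hM0 : 0 ≤ M := (norm_nonneg _).trans (hM 0)
  -- Makes the error 2ε‖y' + ys n‖ at most δ/2; two further errors of δ/8 follow.
  set ε := δ / (4 * (‖y'‖ + M + 1)) with hε_def
  have hε : 0 < ε := by positivity
  have hεM : ε * (‖y'‖ + M + 1) = δ / 4 := by rw [hε_def]; field_simp
  obtain ⟨S, hSc, hSn, hSy⟩ : ∃ S : X →L[𝕜] Y, IsCompactOperator S ∧ ‖S‖ ≤ 1 + ε ∧
      y'.comp S = x' := by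
    by_cases hy : y' = 0
    · refine ⟨0, isCompactOperator_zero, by simp; positivity, ?_⟩
      have : x' = 0 := by simpa [hy] using hxy
      simp [this]
    have hy0 : 0 < ‖y'‖ := norm_pos_iff.2 hy
    obtain ⟨y, hy1, hyy⟩ := y'.exists_lt_apply_of_lt_opNorm (r := ‖y'‖ / (1 + ε))
      (div_lt_self hy0 (by linarith))
    have hyy0 : 0 < ‖y' y‖ := lt_of_le_of_lt (by positivity) hyy
    -- Rank one, with `y` almost norming `y'`.
    refine ⟨x'.smulRight ((y' y)⁻¹ • y), ?_, ?_, ?_⟩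
    · have h1 : IsCompactOperator (ContinuousLinearMap.toSpanSingleton 𝕜 ((y' y)⁻¹ • y)) :=
        isCompactOperator_of_locallyCompactSpace_rng _
      exact h1.comp_clm x'
    · rw [ContinuousLinearMap.norm_smulRight_apply, norm_smul, norm_inv]
      rw [div_lt_iff₀ (by positivity)] at hyy
      calc ‖x'‖ * (‖y' y‖⁻¹ * ‖y‖) ≤ ‖y'‖ * (‖y' y‖⁻¹ * 1) := by gcongr
        _ = ‖y'‖ / ‖y' y‖ := by rw [mul_one, div_eq_mul_inv]
        _ ≤ 1 + ε := by rw [div_le_iff₀ hyy0]; linarith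
    · ext x
      have : y' y ≠ 0 := norm_pos_iff.1 hyy0
      simp [this]
  -- Separation yields only some point of a convex set, so what is needed of `U` is imposed as a
  -- convex condition that (b) secures for almost all `K n ∘ T`.
  set C : Set (X →L[𝕜] Y) := {U | IsCompactOperator U ∧ ‖y'.comp U - y'.comp T‖ ≤ δ / 8} with hCdef
  obtain ⟨U, ⟨hUc, hUy⟩, hU⟩ := hJ.exists_norm_add_sub_lt (r := 1 + ε) (ε := ε) (C := C)
    ha hc hK hSc (T := T) (by positivity) hε hSn (by linarith)
    (by
      rintro U ⟨hUc, hUn⟩ U' ⟨hUc', hUn'⟩ a b ha0 hb0 hab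
      refine ⟨(hUc.smul (a : 𝕜)).add (hUc'.smul (b : 𝕜)), ?_⟩
      have : y'.comp ((a : 𝕜) • U + (b : 𝕜) • U') - y'.comp T =
          (a : 𝕜) • (y'.comp U - y'.comp T) + (b : 𝕜) • (y'.comp U' - y'.comp T) := by
        have hab' : (a : 𝕜) + (b : 𝕜) = 1 := by rw [← RCLike.ofReal_add, hab, RCLike.ofReal_one]
        ext x
        simp only [ContinuousLinearMap.comp_apply, _root_.add_apply, _root_.sub_apply,
          _root_.smul_apply, map_add, map_smul, smul_eq_mul]
        linear_combination y' (T x) * hab'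
      rw [this]
      calc _ ≤ a * (δ / 8) + b * (δ / 8) := by
            refine (norm_add_le _ _).trans ?_
            rw [norm_smul, norm_smul, RCLike.norm_ofReal, RCLike.norm_ofReal, abs_of_nonneg ha0,
              abs_of_nonneg hb0]
            gcongr
        _ = δ / 8 := by rw [← add_mul, hab, one_mul])
    (by
      have h1 : Tendsto (fun n => ‖y'.comp (K n) - y'‖) atTop (𝓝 0) :=
        tendsto_iff_norm_sub_tendsto_zero.1 (hb y')
      filter_upwards [h1.eventually_lt_const (show 0 < δ / 8 by positivity)] with n hn
      refine ⟨(hK n).comp_clm T, ?_⟩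
      rw [← ContinuousLinearMap.comp_assoc, ← ContinuousLinearMap.sub_comp]
      calc _ ≤ ‖y'.comp (K n) - y'‖ * ‖T‖ := ContinuousLinearMap.opNorm_comp_le _ _
        _ ≤ (δ / 8) * 1 := by gcongr
        _ = δ / 8 := mul_one _)
  have hcomp : ∀ {R : X →L[𝕜] Y}, IsCompactOperator R →
      Tendsto (fun n => ‖(ys n).comp R‖) atTop (𝓝 0) := fun {R} hR => by
    have h := tendsto_comp_of_isCompactOperator (A := ys) (B := 0)
      (Eventually.of_forall (f := atTop) hM) (by simpa using hys) hR
    simpa using h.norm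
  filter_upwards [(hcomp (R := U - S) (hUc.sub hSc)).eventually_lt_const (show 0 < δ / 8 by positivity)]
    with n hn
  have hdec : x' + (ys n).comp T = (y' + ys n).comp (S + T - U) + (y'.comp U - y'.comp T) +
      (ys n).comp (U - S) := by
    rw [← hSy]
    ext x
    simp only [ContinuousLinearMap.comp_apply, _root_.add_apply, _root_.sub_apply, map_add,
      map_sub]
    ring
  rw [hdec]
  have hyn : ‖y' + ys n‖ ≤ ‖y'‖ + M := (norm_add_le _ _).trans (by gcongr; exact hM n)
  calc _ ≤ ‖y' + ys n‖ * (1 + ε + ε) + δ / 8 + δ / 8 := by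
        refine (norm_add₃_le).trans ?_
        gcongr
        exact (ContinuousLinearMap.opNorm_comp_le _ _).trans (by gcongr)
    _ ≤ ‖y' + ys n‖ + δ := by nlinarith [norm_nonneg (y' + ys n)]

end Forward

/-! ### From the averaged property to the M-ideal. -/

section Backward

variable {𝕜 X Y : Type*} [RCLike 𝕜] [NormedAddCommGroup X] [NormedSpace 𝕜 X]
  [NormedAddCommGroup Y] [NormedSpace 𝕜 Y]

/-- If `‖1 - 2 K n‖ → 1` then `K m ± (1 - K n)` has norm almost at most `1` for `n ≫ m ≫ 1`. -/
theorem eventually_eventually_norm_add_sub_le {K : ℕ → Y →L[𝕜] Y}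
    (hK : ∀ n, IsCompactOperator (K n)) (ha : ∀ y : Y, Tendsto (fun n => K n y) atTop (𝓝 y))
    (hc : Tendsto (fun n => ‖ContinuousLinearMap.id 𝕜 Y - (2 : 𝕜) • K n‖) atTop (𝓝 1))
    {η : ℝ} (hη : 0 < η) :
    ∀ᶠ m in atTop, ∀ᶠ n in atTop,
      ‖K m + (ContinuousLinearMap.id 𝕜 Y - K n)‖ ≤ 1 + η ∧
      ‖K m - (ContinuousLinearMap.id 𝕜 Y - K n)‖ ≤ 1 + η := by
  set I := ContinuousLinearMap.id 𝕜 Y with hI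
  have hI1 : ‖I‖ ≤ 1 := ContinuousLinearMap.norm_id_le
  set c := min 1 (η / 3) with hc_def
  have hc0 : 0 < c := lt_min one_pos (by positivity)
  have hc1 : c ≤ 1 := min_le_left _ _
  have hcη : c ≤ η / 3 := min_le_right _ _
  have h2 : ‖(2 : 𝕜)‖ = 2 := by simp
  have h2i : ‖(2 : 𝕜)⁻¹‖ = 2⁻¹ := by simp
  have hev : ∀ᶠ n in atTop, ‖I - (2 : 𝕜) • K n‖ < 1 + c :=
    hc.eventually_lt_const (by linarith)
  filter_upwards [hev] with m hm
  have hlim : Tendsto (fun n => (K n).comp (K m)) atTop (𝓝 (I.comp (K m))) :=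
    tendsto_comp_of_isCompactOperator (eventually_norm_le_of_tendsto hc one_lt_two)
      (fun y => ha y) (hK m)
  have hlim' := (tendsto_iff_norm_sub_tendsto_zero.1 hlim).eventually_lt_const
    (show 0 < η / 4 by positivity)
  filter_upwards [hev, hlim'] with n hn hnm
  constructor
  -- The product of two almost contractive operators reproduces K m + (I - K n) up to K n ∘ K m - K
  -- m, which is small as K m is compact.
  · have hdec : K m + (I - K n) =
        (2 : 𝕜)⁻¹ • (I + (I - (2 : 𝕜) • K n).comp (I - (2 : 𝕜) • K m)) -
          (2 : 𝕜) • ((K n).comp (K m) - I.comp (K m)) := by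
      ext y
      simp only [hI, ContinuousLinearMap.comp_apply, _root_.add_apply, _root_.sub_apply,
        _root_.smul_apply, map_sub, map_smul, ContinuousLinearMap.id_apply]
      module
    rw [hdec]
    have h1 : ‖(I - (2 : 𝕜) • K n).comp (I - (2 : 𝕜) • K m)‖ ≤ (1 + c) * (1 + c) :=
      (ContinuousLinearMap.opNorm_comp_le _ _).trans (by gcongr)
    calc _ ≤ 2⁻¹ * (1 + (1 + c) * (1 + c)) + 2 * (η / 4) := by
          refine (norm_sub_le _ _).trans ?_
          rw [norm_smul, norm_smul, h2, h2i]
          gcongr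
          exact (norm_add_le _ _).trans (by gcongr)
      _ ≤ 1 + η := by nlinarith
  · have hdec : K m - (I - K n) =
        -((2 : 𝕜)⁻¹ • ((I - (2 : 𝕜) • K n) + (I - (2 : 𝕜) • K m))) := by
      ext y
      simp only [hI, _root_.add_apply, _root_.sub_apply, _root_.neg_apply,
        _root_.smul_apply, ContinuousLinearMap.id_apply]
      module
    rw [hdec, norm_neg, norm_smul, h2i]
    calc _ ≤ 2⁻¹ * ((1 + c) + (1 + c)) := by
          gcongr
          exact (norm_add_le _ _).trans (by gcongr)
      _ ≤ 1 + η := by linarith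

theorem exists_strongDual_lt_norm_comp {A : X →L[𝕜] Y} {c : ℝ} (hc : c < ‖A‖) :
    ∃ f : StrongDual 𝕜 Y, ‖f‖ ≤ 1 ∧ c < ‖f.comp A‖ := by
  obtain ⟨x, hx, hxc⟩ := A.exists_lt_apply_of_lt_opNorm hc
  obtain ⟨f, hf, hfx⟩ := exists_dual_vector'' 𝕜 (A x)
  refine ⟨f, hf, hxc.trans_le ?_⟩
  calc ‖A x‖ = ‖(f.comp A) x‖ := by rw [ContinuousLinearMap.comp_apply, hfx]; simp
    _ ≤ ‖f.comp A‖ * ‖x‖ := ContinuousLinearMap.le_opNorm _ _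
    _ ≤ ‖f.comp A‖ := mul_le_of_le_one_right (norm_nonneg _) hx.le

theorem tendsto_norm_comp_sub_comp {f : ℕ → StrongDual 𝕜 Y} {g : StrongDual 𝕜 Y} {r : ℝ}
    (hf : ∀ k, ‖f k‖ ≤ r) (hg : ∀ y, Tendsto (fun k => f k y) atTop (𝓝 (g y)))
    {S : X →L[𝕜] Y} (hS : IsCompactOperator S) :
    Tendsto (fun k => ‖g.comp S - (f k).comp S‖) atTop (𝓝 0) := by
  have h := tendsto_comp_of_isCompactOperator (Eventually.of_forall (f := atTop) hf) hg hS
  simpa only [norm_sub_rev] using tendsto_iff_norm_sub_tendsto_zero.1 h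

/-- Otherwise take almost norming functionals f_k with weak* limit g. The property, applied to S*g,
g and the weak* null sequence z_k = (I - K_n)*f_k, bounds S*g + T*z_k ≈ (S + T - K_n T)*f_k by
p-means of ‖g ± z_k‖. Since g ≈ K_m*g ≈ K_m*f_k, these norms are almost those of f_k ∘ (K_m ± (I -
K_n)). -/
theorem HasAveragedMStar.eventually_norm_add_lt {p : ℝ≥0∞} (hp : 1 ≤ p)
    {K : ℕ → Y →L[𝕜] Y} (hK : ∀ n, IsCompactOperator (K n))
    (ha : ∀ y : Y, Tendsto (fun n => K n y) atTop (𝓝 y))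
    (hb : ∀ f : StrongDual 𝕜 Y, Tendsto (fun n => f.comp (K n)) atTop (𝓝 f))
    (hc : Tendsto (fun n => ‖ContinuousLinearMap.id 𝕜 Y - (2 : 𝕜) • K n‖) atTop (𝓝 1))
    {S T : X →L[𝕜] Y} (hT : HasAveragedMStar p T) (hS : IsCompactOperator S) (hS1 : ‖S‖ ≤ 1)
    {δ : ℝ} (hδ : 0 < δ) :
    ∀ᶠ n in atTop, ‖S + (T - (K n).comp T)‖ < 1 + δ := by
  have hsep := separableSpace_of_tendsto_compact hK ha
  by_contra hcon
  obtain ⟨φ, hφ, hφδ⟩ := extraction_of_frequently_atTop (not_eventually.1 hcon)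
  have hex : ∀ k, ∃ f : StrongDual 𝕜 Y, ‖f‖ ≤ 1 ∧
      1 + δ / 2 < ‖f.comp (S + (T - (K (φ k)).comp T))‖ := fun k =>
    exists_strongDual_lt_norm_comp (by have := not_lt.1 (hφδ k); linarith)
  choose f hf1 hfδ using hex
  obtain ⟨g, ψ, hg1, hψ, hg⟩ := exists_strictMono_tendsto_strongDual hf1
  have hφψ : Tendsto (fun k => φ (ψ k)) atTop atTop := (hφ.comp hψ).tendsto_atTop
  set z : ℕ → StrongDual 𝕜 Y := fun k =>
    (f (ψ k)).comp (ContinuousLinearMap.id 𝕜 Y - K (φ (ψ k))) with hz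
  have hz0 : Tendsto (fun k => StrongDual.toWeakDual (z k)) atTop (𝓝 0) := by
    rw [tendsto_toWeakDual_zero_iff]
    intro y
    have h1 : Tendsto (fun k => ‖y - K (φ (ψ k)) y‖) atTop (𝓝 0) := by
      simpa using ((tendsto_const_nhds (x := y)).sub ((ha y).comp hφψ)).norm
    refine squeeze_zero_norm (fun k => ?_) h1
    calc ‖z k y‖ ≤ ‖f (ψ k)‖ * ‖y - K (φ (ψ k)) y‖ := (f (ψ k)).le_opNorm _
      _ ≤ ‖y - K (φ (ψ k)) y‖ := mul_le_of_le_one_left (norm_nonneg _) (hf1 _)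
  have hprop := hT (g.comp S) g z
    ((ContinuousLinearMap.opNorm_comp_le _ _).trans
      (mul_le_of_le_one_right (norm_nonneg _) hS1)) hz0
  have hlow : ((1 + δ / 4 : ℝ) : EReal) ≤
      limsup (fun k => ((‖g.comp S + (z k).comp T‖ : ℝ) : EReal)) atTop := by
    refine le_limsup_of_frequently_le (Eventually.frequently ?_)
    filter_upwards [(tendsto_norm_comp_sub_comp (fun k => hf1 (ψ k)) hg hS).eventually_lt_const (show 0 < δ / 4 by positivity)] with k hk
    rw [EReal.coe_le_coe_iff]
    have hdec : (f (ψ k)).comp (S + (T - (K (φ (ψ k))).comp T)) =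
        (g.comp S + (z k).comp T) - (g.comp S - (f (ψ k)).comp S) := by
      ext x
      simp only [hz, ContinuousLinearMap.comp_apply, _root_.add_apply, _root_.sub_apply, map_add,
        map_sub, ContinuousLinearMap.id_apply]
      ring
    have h1 := hfδ (ψ k)
    rw [hdec] at h1
    have := norm_sub_le (g.comp S + (z k).comp T) (g.comp S - (f (ψ k)).comp S)
    linarith
  have hup : limsup (fun k => ((pMean p ‖g + z k‖ ‖g - z k‖ : ℝ) : EReal)) atTop ≤
      ((1 + δ / 8 : ℝ) : EReal) := by
    refine limsup_le_of_le (h := ?_)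
    have h1 := (tendsto_iff_norm_sub_tendsto_zero.1 (hb g)).eventually_lt_const
      (show 0 < δ / 32 by positivity)
    -- Here `m` is fixed before `k` grows: compactness of K m makes (g - f_k) ∘ K m small.
    obtain ⟨m, hm, hmg⟩ := ((eventually_eventually_norm_add_sub_le hK ha hc
      (show 0 < δ / 32 by positivity)).and h1).exists
    filter_upwards [hφψ.eventually hm,
      (tendsto_norm_comp_sub_comp (fun k => hf1 (ψ k)) hg (hK m)).eventually_lt_const (show 0 < δ / 32 by positivity)] with k hk hkm
    rw [norm_sub_rev] at hmg
    have hf : ∀ A : Y →L[𝕜] Y, ‖A‖ ≤ 1 + δ / 32 → ‖(f (ψ k)).comp A‖ ≤ 1 + δ / 32 := fun A hA =>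
      (ContinuousLinearMap.opNorm_comp_le _ _).trans
        ((mul_le_of_le_one_left (norm_nonneg _) (hf1 _)).trans hA)
    have hd1 : g + z k = (g - g.comp (K m)) + (g.comp (K m) - (f (ψ k)).comp (K m)) +
        (f (ψ k)).comp (K m + (ContinuousLinearMap.id 𝕜 Y - K (φ (ψ k)))) := by
      rw [ContinuousLinearMap.comp_add]; abel
    have hd2 : g - z k = (g - g.comp (K m)) + (g.comp (K m) - (f (ψ k)).comp (K m)) +
        (f (ψ k)).comp (K m - (ContinuousLinearMap.id 𝕜 Y - K (φ (ψ k)))) := by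
      rw [ContinuousLinearMap.comp_sub]; abel
    rw [EReal.coe_le_coe_iff]
    refine pMean_le hp (norm_nonneg _) (norm_nonneg _) ?_ ?_
    · rw [hd1]
      refine norm_add₃_le.trans ?_
      linarith [hf _ hk.1]
    · rw [hd2]
      refine norm_add₃_le.trans ?_
      linarith [hf _ hk.2]
  have := EReal.coe_le_coe_iff.1 (hlow.trans (hprop.trans hup))
  linarith

/-- Functionals on `X →L[𝕜] Y` which are continuous along an approximate identity, with respect to
a fixed nonprincipal ultrafilter. -/
def approxIdentityContinuous (X : Type*) [NormedAddCommGroup X] [NormedSpace 𝕜 X]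
    (K : ℕ → Y →L[𝕜] Y) : Submodule 𝕜 (StrongDual 𝕜 (X →L[𝕜] Y)) where
  carrier := {f | ∀ T, Tendsto (fun n => f ((K n).comp T)) (hyperfilter ℕ) (𝓝 (f T))}
  zero_mem' := fun T => by simp
  add_mem' := fun {f g} hf hg T => (hf T).add (hg T)
  smul_mem' := fun c f hf T => (hf T).const_smul c

/-- Closedness of V is automatic: if f + g is within ε of w ∈ V, then ‖f‖ ≤ ‖f + (g - w)‖ < ε. -/
theorem isMIdeal_of_isCompl_of_norm_add {E : Type*} [NormedAddCommGroup E] [NormedSpace 𝕜 E]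
    {J : Submodule 𝕜 E} (hJ : IsClosed (J : Set E)) {V : Submodule 𝕜 (StrongDual 𝕜 E)}
    (hV : IsCompl (annihilatorInDual J) V)
    (h : ∀ f ∈ annihilatorInDual J, ∀ g ∈ V, ‖f‖ + ‖g‖ ≤ ‖f + g‖) : IsMIdeal J := by
  refine ⟨hJ, V, ?_, hV, fun f hf g hg => le_antisymm (norm_add_le _ _) (h f hf g hg)⟩
  refine isClosed_of_closure_subset fun u hu => ?_
  obtain ⟨f, hf, g, hg, rfl⟩ : ∃ f ∈ annihilatorInDual J, ∃ g ∈ V, f + g = u := by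
    have : u ∈ annihilatorInDual J ⊔ V := by rw [hV.sup_eq_top]; trivial
    exact Submodule.mem_sup.1 this
  have hf0 : ‖f‖ ≤ 0 := le_of_forall_pos_le_add fun ε hε => by
    obtain ⟨w, hw, hd⟩ := Metric.mem_closure_iff.1 hu ε hε
    rw [dist_eq_norm, add_sub_assoc] at hd
    have := h f hf (g - w) (V.sub_mem hg hw)
    linarith [norm_nonneg (g - w)]
  rw [norm_le_zero_iff.1 hf0, zero_add]
  exact hg

theorem isMIdeal_compactOperator_of_eventually_norm_add_lt [CompleteSpace Y]
    {K : ℕ → Y →L[𝕜] Y} (hK : ∀ n, IsCompactOperator (K n))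
    (ha : ∀ y : Y, Tendsto (fun n => K n y) atTop (𝓝 y))
    (hb : ∀ c : ℝ, 1 < c → ∀ᶠ n in atTop, ‖K n‖ ≤ c)
    (h : ∀ S T : X →L[𝕜] Y, IsCompactOperator S → ‖S‖ ≤ 1 → ‖T‖ ≤ 1 → ∀ δ > 0,
      ∀ᶠ n in atTop, ‖S + (T - (K n).comp T)‖ < 1 + δ) :
    IsMIdeal (𝕜 := 𝕜) (compactOperator (RingHom.id 𝕜) X Y) := by
  set J := compactOperator (RingHom.id 𝕜) X Y with hJ
  have hle : (hyperfilter ℕ : Filter ℕ) ≤ atTop := Nat.hyperfilter_le_atTop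
  have hKJ : ∀ n (T : X →L[𝕜] Y), (K n).comp T ∈ J := fun n T => (hK n).comp_clm T
  refine isMIdeal_of_isCompl_of_norm_add (V := approxIdentityContinuous X K)
    isClosed_setOfPred_isCompactOperator ⟨?_, ?_⟩ ?_
  · rw [Submodule.disjoint_def]
    intro f hf hfV
    ext T
    refine tendsto_nhds_unique (hfV T) ?_
    simp [hf _ (hKJ _ T)]
  · rw [codisjoint_iff, eq_top_iff]
    intro f _
    obtain ⟨g, hg⟩ := (hyperfilter ℕ).exists_tendsto_strongDual (r := ‖f‖ * 2)
      (f := fun n => f.comp (ContinuousLinearMap.compL 𝕜 X Y Y (K n))) (by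
        filter_upwards [hle (hb 2 one_lt_two)] with n hn
        refine ContinuousLinearMap.opNorm_le_bound _ (by positivity) fun T => ?_
        calc ‖f ((K n).comp T)‖ ≤ ‖f‖ * (‖K n‖ * ‖T‖) :=
              (f.le_opNorm _).trans (by gcongr; exact ContinuousLinearMap.opNorm_comp_le _ _)
          _ ≤ ‖f‖ * 2 * ‖T‖ := by rw [mul_assoc]; gcongr)
    have hfg : ∀ S ∈ J, f S = g S := fun S hS => by
      have h1 : Tendsto (fun n => (K n).comp S) (hyperfilter ℕ)
          (𝓝 ((ContinuousLinearMap.id 𝕜 Y).comp S)) :=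
        (tendsto_comp_of_isCompactOperator (hb 2 one_lt_two) (fun y => by simpa using ha y)
          hS).mono_left hle
      exact tendsto_nhds_unique ((f.continuous.tendsto _).comp h1) (hg S)
    -- `g` lies in V because `f` and `g` agree on J, which contains every K n ∘ T.
    refine Submodule.mem_sup.2 ⟨f - g, fun S hS => by simp [hfg S hS], g, fun T => ?_, by simp⟩
    refine (hg T).congr fun n => ?_
    exact hfg _ (hKJ n T)
  · intro f hf g hg
    by_contra! hlt
    set d := (‖f‖ + ‖g‖ - ‖f + g‖) / 4 with hd
    have hd0 : 0 < d := by linarith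
    set δ := d / (‖f + g‖ + 1) with hδ
    have hδ0 : 0 < δ := by positivity
    have hδd : ‖f + g‖ * (1 + δ) ≤ ‖f + g‖ + d := by
      have : (‖f + g‖ + 1) * δ = d := by rw [hδ]; field_simp
      linarith
    obtain ⟨T, t, hT, ht, hfT⟩ := exists_apply_eq_ofReal_of_lt_norm (f := f) (c := ‖f‖ - d)
      (by linarith)
    obtain ⟨S, s, hS, hs, hgS⟩ := exists_apply_eq_ofReal_of_lt_norm (f := g) (c := ‖g‖ - d)
      (by linarith)
    have hlim : ‖g S + f T‖ ≤ ‖f + g‖ * (1 + δ) := by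
      refine le_of_tendsto ((hg S).add_const (f T)).norm ?_
      -- `S` need not be compact, so it is replaced by K m ∘ S. The strict bound ‖S‖ < 1 leaves room
      -- for ‖K m‖ slightly above 1.
      filter_upwards [hle (hb (2 / (1 + ‖S‖)) (by
        rw [lt_div_iff₀ (by positivity)]; linarith))] with m hm
      have hmS : ‖(K m).comp S‖ ≤ 1 := by
        calc _ ≤ 2 / (1 + ‖S‖) * ‖S‖ :=
              (ContinuousLinearMap.opNorm_comp_le _ _).trans (by gcongr)
          _ ≤ 1 := by rw [div_mul_eq_mul_div, div_le_one (by positivity)]; linarith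
      -- These are the values of f + g at K m ∘ S + (T - K n ∘ T), because f vanishes on compact
      -- operators.
      have h1 : Tendsto (fun n => g ((K m).comp S) + f T + (g T - g ((K n).comp T)))
          (hyperfilter ℕ) (𝓝 (g ((K m).comp S) + f T + (g T - g T))) :=
        tendsto_const_nhds.add (tendsto_const_nhds.sub (hg T))
      rw [sub_self, add_zero] at h1
      refine le_of_tendsto h1.norm ?_
      filter_upwards [hle (h _ T ((hK m).comp_clm S) hmS hT.le δ hδ0)] with n hn
      calc _ = ‖(f + g) ((K m).comp S + (T - (K n).comp T))‖ := by
            congr 1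
            simp only [_root_.add_apply, map_add, map_sub, hf _ (hKJ _ _)]
            ring
        _ ≤ ‖f + g‖ * (1 + δ) := ((f + g).le_opNorm _).trans (by gcongr)
    rw [hfT, hgS, ← RCLike.ofReal_add, RCLike.norm_ofReal] at hlim
    have := le_abs_self (s + t)
    linarith

end Backward

/-! ### Upper limits and the conclusion. -/

theorem EReal.limsup_coe_le_limsup_coe_of_forall_eventually_le_add {ι : Type*} {l : Filter ι}
    {u v : ι → ℝ} (h : ∀ δ > 0, ∀ᶠ i in l, u i ≤ v i + δ) :
    limsup (fun i => (u i : EReal)) l ≤ limsup (fun i => (v i : EReal)) l := by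
  refine EReal.le_of_forall_lt_iff_le.1 fun z hz => ?_
  obtain ⟨w, hw, hwz⟩ := EReal.lt_iff_exists_real_btwn.1 hz
  rw [EReal.coe_lt_coe_iff] at hwz
  refine limsup_le_of_le (h := ?_)
  filter_upwards [eventually_lt_of_limsup_lt hw, h (z - w) (by linarith)] with i hi hi'
  rw [EReal.coe_lt_coe_iff] at hi
  rw [EReal.coe_le_coe_iff]
  linarith

theorem proposition3p73 {𝕜 : Type*} [RCLike 𝕜] (p : ℝ≥0∞) (hp : 1 ≤ p)
    {Y : Type*} [NormedAddCommGroup Y] [NormedSpace 𝕜 Y] [CompleteSpace Y]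
    (K : ℕ → Y →L[𝕜] Y) (hK : ∀ n, IsCompactOperator (K n))
    (ha : ∀ y : Y, Tendsto (fun n => K n y) atTop (𝓝 y))
    (hb : ∀ f : StrongDual 𝕜 Y, Tendsto (fun n => f.comp (K n)) atTop (𝓝 f))
    (hc : Tendsto (fun n => ‖ContinuousLinearMap.id 𝕜 Y - (2 : 𝕜) • K n‖) atTop (𝓝 1))
    {X : Type*} [NormedAddCommGroup X] [NormedSpace 𝕜 X] [CompleteSpace X] :
    IsMIdeal (𝕜 := 𝕜) (compactOperator (RingHom.id 𝕜) X Y) ↔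
      ∀ T : X →L[𝕜] Y, ‖T‖ ≤ 1 → HasAveragedMStar p T := by
  have hKn : ∀ c : ℝ, 1 < c → ∀ᶠ n in atTop, ‖K n‖ ≤ c := fun c =>
    eventually_norm_le_of_tendsto hc
  constructor
  · intro hJ T hT x' y' ys hxy hys
    refine EReal.limsup_coe_le_limsup_coe_of_forall_eventually_le_add fun δ hδ => ?_
    -- The hypothesis ‖x'‖ ≤ ‖y'‖ is insensitive to the sign of y', so both norms in the p-mean are
    -- bounds.
    filter_upwards [hJ.eventually_norm_add_comp_le hK ha hb hKn hT hxy hys hδ,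
      hJ.eventually_norm_add_comp_le hK ha hb hKn hT (x' := x') (y' := -y') (by rwa [norm_neg]) hys hδ]
      with n h1 h2
    rw [neg_add_eq_sub, norm_sub_rev (ys n)] at h2
    have h3 := min_le_pMean hp (norm_nonneg (y' + ys n)) (norm_nonneg (y' - ys n))
    rcases min_choice ‖y' + ys n‖ ‖y' - ys n‖ with h4 | h4 <;> rw [h4] at h3 <;> linarith
  · intro h
    exact isMIdeal_compactOperator_of_eventually_norm_add_lt hK ha hKn fun S T hS hS1 hT δ hδ =>
      (h T hT).eventually_norm_add_lt hp hK ha hb hc hS hS1 hδ
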